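/- Let $d\ge 0$, let $\mathcal X,\mathcal Y\subseteq\mathbb R^d$ be measurable, and let $f,g:\mathbb R^d\to\mathbb R$ be such that $e^{-f}$ on $\mathcal X$ and $e^{-g}$ on $\mathcal Y$ (both extended by $0$) are probability densities with respect to Lebesgue measure; the case $\mathcal X=\mathcal Y=\mathbb R^d$ is included. For $\epsilon>0$ define one Sinkhorn step by $$\mathcal V^{\epsilon}[\psi](y):=\epsilon\log\int_{\mathcal X}\frac{\exp\left(\frac1\epsilon\langle x,y\rangle\right)}{\int_{\mathcal Y}\exp\left(\frac1\epsilon\langle x,y'\rangle-\frac1\epsilon\psi(y')-g(y')\right)dy'}\,e^{-f(x)}\,dx .$$ Let $\psi:\mathbb R^d\to\mathbb R$ be a uniformly strongly convex $\mathcal C^2$ function, i.e. there is $m>0$ such that $\lambda_{\min}(\nabla^2\psi(y))\ge m$ for all $y\in\mathbb R^d$. Let $y$ be an interior point of $\mathcal Y$ such that $\nabla\psi(y)$ is an interior point of $\mathcal X$, and assume that $g$ is continuous at $y$ and $f$ is continuous at $\nabla\psi(y)$. Then for every $\epsilon>0$ the integrals defining $\tilde\psi^\epsilon(y):=\mathcal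 V^\epsilon[\psi](y)$ (the inner one for every $x\in\mathbb R^d$) converge and are positive, so that $\tilde\psi^\epsilon(y)$ is a well-defined real number, and $$\lim_{\epsilon\downarrow 0}\frac{\tilde\psi^{\epsilon}(y)-\psi(y)}{\epsilon}=-f(\nabla\psi(y))+g(y)+\log\det\left(\nabla^2\psi(y)\right).$$ -/

import Mathlib

open MeasureTheory Filter Topology Real
open scoped RealInnerProductSpace

noncomputable section

/-- `exp (-f)` on `X`, extended by `0` outside `X`, is a probability density with respect to
Lebesgue measure on `ℝ^d`. -/
structure IsProbDensityOn {d : ℕ} (X : Set (EuclideanSpace ℝ (Fin d)))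
    (f : EuclideanSpace ℝ (Fin d) → ℝ) : Prop where
  measurableSet : MeasurableSet X
  integrableOn : IntegrableOn (fun x => exp (-f x)) X volume
  integral_eq_one : ∫ x in X, exp (-f x) = 1

/-- The Hessian of `ψ` at `y`, as the derivative of the gradient field. -/
def hessian {d : ℕ} (ψ : EuclideanSpace ℝ (Fin d) → ℝ) (y : EuclideanSpace ℝ (Fin d)) :
    EuclideanSpace ℝ (Fin d) →L[ℝ] EuclideanSpace ℝ (Fin d) :=
  fderiv ℝ (gradient ψ) y

/-- Every eigenvalue of every (symmetric) Hessian `∇²ψ(y)` is at least `m`,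
i.e. `m • Id ≤ ∇²ψ(y)` as quadratic forms, for all `y`. -/
def HessianBoundedBelow {d : ℕ} (m : ℝ) (ψ : EuclideanSpace ℝ (Fin d) → ℝ) : Prop :=
  ∀ y v : EuclideanSpace ℝ (Fin d), m * ‖v‖ ^ 2 ≤ ⟪v, hessian ψ y v⟫

/-- A uniformly strongly convex function of class `C²`. -/
structure IsUniformlyStronglyConvexC2 {d : ℕ} (ψ : EuclideanSpace ℝ (Fin d) → ℝ) : Prop where
  contDiff : ContDiff ℝ 2 ψ
  exists_pos : ∃ m : ℝ, 0 < m ∧ HessianBoundedBelow m ψ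

/-- The integrand in `y'` of the inner normalising integral of a Sinkhorn step. -/
def sinkhornInner {d : ℕ} (g : EuclideanSpace ℝ (Fin d) → ℝ) (ε : ℝ)
    (ψ : EuclideanSpace ℝ (Fin d) → ℝ) (x y' : EuclideanSpace ℝ (Fin d)) : ℝ :=
  exp (1 / ε * ⟪x, y'⟫ - 1 / ε * ψ y' - g y')

/-- The integrand in `x` of the outer integral of a Sinkhorn step, evaluated at `y`. -/
def sinkhornOuter {d : ℕ} (Y : Set (EuclideanSpace ℝ (Fin d)))
    (f g : EuclideanSpace ℝ (Fin d) → ℝ) (ε : ℝ) (ψ : EuclideanSpace ℝ (Fin d) → ℝ)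
    (y x : EuclideanSpace ℝ (Fin d)) : ℝ :=
  exp (1 / ε * ⟪x, y⟫) / (∫ y' in Y, sinkhornInner g ε ψ x y') * exp (-f x)

/-- The Sinkhorn operator at temperature `ε`, for the target density `exp (-f)` on `X` and the
reference density `exp (-g)` on `Y`. -/
def sinkhornStep {d : ℕ} (X Y : Set (EuclideanSpace ℝ (Fin d)))
    (f g : EuclideanSpace ℝ (Fin d) → ℝ) (ε : ℝ) (ψ : EuclideanSpace ℝ (Fin d) → ℝ)
    (y : EuclideanSpace ℝ (Fin d)) : ℝ :=
  ε * log (∫ x in X, sinkhornOuter Y f g ε ψ y x)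

end

/-
Put `t = √ε`, `p = ∇ψ(y)`, `A = ∇²ψ(y)` and blow up both integrals at scale `t`, the inner one
around `y` and the outer one around `p`. By Taylor expansion at `y` the inner integral at
`x = p + t • u` is then `t ^ d * exp ((⟪x, y⟫ - ψ y) / ε)` times a quantity `N_t(u)` tending to
`exp (-g y) * G u`, where `G` is the Laplace transform of the Gaussian weight
`exp (-⟪v, A v⟫ / 2)`, so the outer integral is `exp (ψ y / ε)` times a quantity tending to
`exp (-f p) * exp (g y) * ∫ 1 / G`. Completing the square gives
`G (A w) = exp (⟪w, A w⟫ / 2) * G 0`, whence the substitution `u = A w` evaluates `∫ 1 / G` to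
`det A` without computing `G 0`.

Both limits are instances of one statement on peaked kernels. It needs an integrable majorant that
is uniform in `t`: for the inner kernel it comes from strong convexity, and for `1 / N_t(u)` from
`N_t(u) ≥ c * exp ‖u‖`, obtained by integrating only over a ball centred in the direction of `u`.
-/

section Kernels

variable {E : Type*} [NormedAddCommGroup E]

theorem tendsto_pow_norm_mul_exp_neg_norm_cobounded (n : ℕ) :
    Tendsto (fun x : E => ‖x‖ ^ n * exp (-‖x‖)) (Bornology.cobounded E) (𝓝 0) :=
  (tendsto_pow_mul_exp_neg_atTop_nhds_zero n).comp tendsto_norm_cobounded_atTop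

variable [NormedSpace ℝ E]

/-- The dilation of a kernel `k` to scale `t`, normalised to preserve the integral. -/
noncomputable def dilate (t : ℝ) (k : E → ℝ) (x : E) : ℝ :=
  (t ^ Module.finrank ℝ E)⁻¹ * k (t⁻¹ • x)

theorem tendstoUniformlyOn_dilate {h : ℝ → E → ℝ} {H : E → ℝ}
    (hbd : ∀ᶠ t in 𝓝[>] 0, ∀ u, h t u ∈ Set.Icc 0 (H u))
    (hH : Tendsto (fun u => ‖u‖ ^ Module.finrank ℝ E * H u) (Bornology.cobounded E) (𝓝 0))
    {U : Set E} (hU : U ∈ 𝓝 0) :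
    TendstoUniformlyOn (fun t => dilate t (h t)) 0 (𝓝[>] 0) Uᶜ := by
  rw [Metric.tendstoUniformlyOn_iff]
  intro η hη
  obtain ⟨δ, hδ, hδU⟩ := Metric.mem_nhds_iff.1 hU
  obtain ⟨R, hR⟩ : ∃ R, ∀ u : E, R < ‖u‖ →
      ‖u‖ ^ Module.finrank ℝ E * H u < δ ^ Module.finrank ℝ E * η := by
    obtain ⟨R, -, hR⟩ := (Metric.hasBasis_cobounded_compl_closedBall (0 : E)).eventually_iff.1
      (hH.eventually_lt_const (by positivity : 0 < δ ^ Module.finrank ℝ E * η))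
    exact ⟨R, fun u hu => hR (by simpa using hu)⟩
  have hfar : ∀ᶠ t : ℝ in 𝓝[>] 0, R < t⁻¹ * δ :=
    (tendsto_inv_nhdsGT_zero.atTop_mul_const hδ).eventually_gt_atTop R
  filter_upwards [hbd, hfar, self_mem_nhdsWithin] with t hht hRt (ht : 0 < t) x hx
  have hδx : δ ≤ ‖x‖ := not_lt.1 fun hlt => hx (hδU (by simpa using hlt))
  have hnorm : ‖t⁻¹ • x‖ = t⁻¹ * ‖x‖ := by rw [norm_smul, norm_of_nonneg (by positivity)]
  have hHx := hR (t⁻¹ • x) (hRt.trans_le (by rw [hnorm]; gcongr))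
  obtain ⟨h_nonneg, h_le⟩ := hht (t⁻¹ • x)
  have hval : 0 ≤ dilate t (h t) x := mul_nonneg (by positivity) h_nonneg
  rw [Pi.zero_apply, dist_zero_left, norm_of_nonneg hval]
  refine lt_of_mul_lt_mul_left ?_ (by positivity : 0 ≤ δ ^ Module.finrank ℝ E)
  calc δ ^ Module.finrank ℝ E * dilate t (h t) x
      ≤ ‖x‖ ^ Module.finrank ℝ E * dilate t (h t) x := by gcongr
    _ = ‖t⁻¹ • x‖ ^ Module.finrank ℝ E * h t (t⁻¹ • x) := by
        rw [dilate, hnorm, mul_pow, inv_pow]; ring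
    _ ≤ ‖t⁻¹ • x‖ ^ Module.finrank ℝ E * H (t⁻¹ • x) := by gcongr
    _ < δ ^ Module.finrank ℝ E * η := hHx

end Kernels

section Dilation

variable {E F : Type*} [NormedAddCommGroup E] [NormedSpace ℝ E] [FiniteDimensional ℝ E]
  [MeasurableSpace E] [BorelSpace E] {μ : Measure E} [μ.IsAddHaarMeasure]
  [NormedAddCommGroup F]

theorem integral_eq_pow_smul_integral_comp_add_smul [NormedSpace ℝ F] (G : E → F) (a : E) {t : ℝ}
    (ht : 0 < t) :
    ∫ x, G x ∂μ = t ^ Module.finrank ℝ E • ∫ u, G (a + t • u) ∂μ := by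
  rw [Measure.integral_comp_smul_of_nonneg μ (fun x => G (a + x)) t (hR := ht.le),
    integral_add_left_eq_self, smul_inv_smul₀ (pow_ne_zero _ ht.ne')]

theorem integrable_comp_add_smul_iff (G : E → F) (a : E) {t : ℝ} (ht : t ≠ 0) :
    Integrable (fun u => G (a + t • u)) μ ↔ Integrable G μ := by
  rw [integrable_comp_smul_iff μ (fun x => G (a + x)) ht]
  exact ⟨fun h => by simpa using h.comp_add_left (-a), fun h => h.comp_add_left a⟩

theorem exp_neg_le_mul_one_add_rpow (n : ℕ) {r : ℝ} (hr : 0 ≤ r) :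
    exp (-r) ≤ exp 1 * n.factorial * (1 + r) ^ (-n : ℝ) := by
  have h : (1 + r) ^ n / n.factorial ≤ exp (1 + r) :=
    Real.pow_div_factorial_le_exp _ (by positivity) n
  rw [div_le_iff₀ (by positivity), exp_add] at h
  rw [rpow_neg (by positivity), rpow_natCast, exp_neg, ← div_eq_mul_inv,
    le_div_iff₀ (by positivity), inv_mul_le_iff₀ (exp_pos r)]
  linarith

theorem integrable_exp_neg_norm : Integrable (fun x : E => exp (-‖x‖)) μ := by
  set n := Module.finrank ℝ E + 1
  have h : Integrable (fun x : E => (1 + ‖x‖) ^ (-n : ℝ)) μ := integrable_one_add_norm (by simp [n])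
  refine (h.const_mul (exp 1 * n.factorial)).mono' (by fun_prop) (ae_of_all _ fun x => ?_)
  rw [norm_of_nonneg (exp_pos _).le]
  exact exp_neg_le_mul_one_add_rpow n (norm_nonneg x)

theorem integral_dilate_smul [NormedSpace ℝ F] (k : E → ℝ) (w : E → F) {t : ℝ} (ht : 0 < t) :
    ∫ x, dilate t k x • w x ∂μ = ∫ u, k u • w (t • u) ∂μ := by
  rw [integral_eq_pow_smul_integral_comp_add_smul _ 0 ht, ← integral_smul]
  simp [dilate, smul_smul, ht.ne']

theorem setIntegral_dilate_closedBall (k : E → ℝ) {t : ℝ} (ht : 0 < t) :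
    ∫ x in Metric.closedBall 0 1, dilate t k x ∂μ = ∫ u in Metric.closedBall 0 t⁻¹, k u ∂μ := by
  simp only [dilate]
  rw [integral_const_mul, Measure.setIntegral_comp_smul_of_pos _ _ _ (inv_pos.2 ht),
    smul_closedBall _ _ zero_le_one]
  simp [abs_of_pos ht, ht.ne']

theorem tendsto_setIntegral_dilate_closedBall {h : ℝ → E → ℝ} {h₀ H : E → ℝ}
    (hmeas : ∀ᶠ t in 𝓝[>] 0, AEStronglyMeasurable (h t) μ)
    (hbd : ∀ᶠ t in 𝓝[>] 0, ∀ u, h t u ∈ Set.Icc 0 (H u)) (hH : Integrable H μ)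
    (hlim : ∀ u, Tendsto (fun t => h t u) (𝓝[>] 0) (𝓝 (h₀ u))) :
    Tendsto (fun t => ∫ x in Metric.closedBall 0 1, dilate t (h t) x ∂μ) (𝓝[>] 0)
      (𝓝 (∫ u, h₀ u ∂μ)) := by
  have hdom : Tendsto (fun t : ℝ => ∫ u, (Metric.closedBall 0 t⁻¹).indicator (h t) u ∂μ) (𝓝[>] 0)
      (𝓝 (∫ u, h₀ u ∂μ)) := by
    refine tendsto_integral_filter_of_dominated_convergence H ?_ ?_ hH (ae_of_all _ fun u => ?_)
    · filter_upwards [hmeas] with t ht using ht.indicator measurableSet_closedBall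
    · filter_upwards [hbd] with t ht
      refine ae_of_all _ fun u => (norm_indicator_le_norm_self _ _).trans ?_
      rw [norm_of_nonneg (ht u).1]
      exact (ht u).2
    · refine (hlim u).congr' ?_
      filter_upwards [tendsto_inv_nhdsGT_zero.eventually_ge_atTop ‖u‖] with t ht
      rw [Set.indicator_of_mem (by simpa using ht)]
  refine hdom.congr' ?_
  filter_upwards [self_mem_nhdsWithin] with t ht
  rw [setIntegral_dilate_closedBall _ ht, integral_indicator measurableSet_closedBall]

theorem tendsto_integral_smul_comp_smul_of_integral_eq_one [NormedSpace ℝ F] [CompleteSpace F]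
    {h : ℝ → E → ℝ} {h₀ H : E → ℝ} {w : E → F}
    (hmeas : ∀ᶠ t in 𝓝[>] 0, AEStronglyMeasurable (h t) μ)
    (hbd : ∀ᶠ t in 𝓝[>] 0, ∀ u, h t u ∈ Set.Icc 0 (H u)) (hH : Integrable H μ)
    (hHdecay : Tendsto (fun u => ‖u‖ ^ Module.finrank ℝ E * H u) (Bornology.cobounded E) (𝓝 0))
    (hlim : ∀ u, Tendsto (fun t => h t u) (𝓝[>] 0) (𝓝 (h₀ u))) (hone : ∫ u, h₀ u ∂μ = 1)
    (hw : Integrable w μ) (hwc : ContinuousAt w 0) :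
    Tendsto (fun t => ∫ u, h t u • w (t • u) ∂μ) (𝓝[>] 0) (𝓝 (w 0)) := by
  have hpeak : Tendsto (fun t => ∫ x, dilate t (h t) x • w x ∂μ) (𝓝[>] 0) (𝓝 (w 0)) := by
    refine tendsto_integral_peak_smul_of_integrable_of_tendsto measurableSet_closedBall
      (Metric.closedBall_mem_nhds 0 one_pos) measure_closedBall_lt_top.ne ?_
      (fun U hU h0U => tendstoUniformlyOn_dilate hbd hHdecay (hU.mem_nhds h0U))
      (hone ▸ tendsto_setIntegral_dilate_closedBall hmeas hbd hH hlim) ?_ hw hwc.tendsto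
    · filter_upwards [hbd, self_mem_nhdsWithin] with t hht (ht : 0 < t) x
      exact mul_nonneg (by positivity) (hht (t⁻¹ • x)).1
    · filter_upwards [hmeas, self_mem_nhdsWithin] with t hht (ht : 0 < t)
      exact (hht.comp_quasiMeasurePreserving
        (Measure.quasiMeasurePreserving_smul μ (inv_ne_zero ht.ne'))).const_mul _
  refine hpeak.congr' ?_
  filter_upwards [self_mem_nhdsWithin] with t ht using integral_dilate_smul _ _ ht

theorem tendsto_integral_smul_comp_smul [NormedSpace ℝ F] [CompleteSpace F]
    {h : ℝ → E → ℝ} {h₀ H : E → ℝ} {w : E → F}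
    (hmeas : ∀ᶠ t in 𝓝[>] 0, AEStronglyMeasurable (h t) μ)
    (hbd : ∀ᶠ t in 𝓝[>] 0, ∀ u, h t u ∈ Set.Icc 0 (H u)) (hH : Integrable H μ)
    (hHdecay : Tendsto (fun u => ‖u‖ ^ Module.finrank ℝ E * H u) (Bornology.cobounded E) (𝓝 0))
    (hlim : ∀ u, Tendsto (fun t => h t u) (𝓝[>] 0) (𝓝 (h₀ u))) (hpos : 0 < ∫ u, h₀ u ∂μ)
    (hw : Integrable w μ) (hwc : ContinuousAt w 0) :
    Tendsto (fun t => ∫ u, h t u • w (t • u) ∂μ) (𝓝[>] 0) (𝓝 ((∫ u, h₀ u ∂μ) • w 0)) := by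
  set I := ∫ u, h₀ u ∂μ with hI
  have hnormalized : Tendsto (fun t => ∫ u, (I⁻¹ * h t u) • w (t • u) ∂μ) (𝓝[>] 0) (𝓝 (w 0)) := by
    refine tendsto_integral_smul_comp_smul_of_integral_eq_one (H := fun u => I⁻¹ * H u)
      (hmeas.mono fun t ht => ht.const_mul _) ?_ (hH.const_mul _) ?_
      (fun u => (hlim u).const_mul _) ?_ hw hwc
    · filter_upwards [hbd] with t ht u
      obtain ⟨h_nonneg, h_le⟩ := ht u
      exact ⟨by positivity, by gcongr⟩
    · simpa only [mul_left_comm, mul_zero] using hHdecay.const_mul I⁻¹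
    · rw [integral_const_mul, ← hI, inv_mul_cancel₀ hpos.ne']
  simp only [mul_smul, integral_smul] at hnormalized
  simpa only [smul_inv_smul₀ hpos.ne'] using hnormalized.const_smul I

end Dilation

section SecondOrderExpansion

variable {E : Type*} [NormedAddCommGroup E] [InnerProductSpace ℝ E] {A : E →L[ℝ] E}

theorem hasFDerivAt_inner_self_apply_div_two (hA : (A : E →ₗ[ℝ] E).IsSymmetric) (v : E) :
    HasFDerivAt (fun v => ⟪v, A v⟫ / 2) (innerSL ℝ (A v)) v := by
  have h := ((hasFDerivAt_id v).inner ℝ A.hasFDerivAt).mul_const (2⁻¹ : ℝ)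
  refine h.congr_fderiv ?_
  ext w
  have hsymm : ⟪v, A w⟫ = ⟪A v, w⟫ := (hA v w).symm
  simp only [id_eq, smul_apply, ContinuousLinearMap.comp_apply, ContinuousLinearMap.prod_apply,
    ContinuousLinearMap.id_apply, fderivInnerCLM_apply, hsymm, real_inner_comm (A v) w,
    smul_eq_mul, coe_innerSL_apply]
  ring

variable [CompleteSpace E] {ψ : E → ℝ} {y : E} {m : ℝ}

theorem isSymmetric_of_hasFDerivAt_gradient (hψ : ∀ᶠ z in 𝓝 y, DifferentiableAt ℝ ψ z)
    (hA : HasFDerivAt (gradient ψ) A y) : (A : E →ₗ[ℝ] E).IsSymmetric := by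
  intro v w
  have hfderiv : HasFDerivAt (fun z => innerSL ℝ (gradient ψ z)) ((innerSL ℝ).comp A) y :=
    (innerSL ℝ).hasFDerivAt.comp y hA
  have hsymm := second_derivative_symmetric_of_eventually
    (hψ.mono fun z hz => hz.hasGradientAt.hasFDerivAt) hfderiv v w
  rw [real_inner_comm _ v]
  exact hsymm

theorem isLittleO_taylor_gradient (hψ : ∀ᶠ z in 𝓝 y, DifferentiableAt ℝ ψ z)
    (hA : HasFDerivAt (gradient ψ) A y) :
    (fun v => ψ (y + v) - ψ y - ⟪gradient ψ y, v⟫ - ⟪v, A v⟫ / 2) =o[𝓝 0] fun v => ‖v‖ ^ 2 := by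
  set F : E → ℝ := fun v => ψ (y + v) - ψ y - ⟪gradient ψ y, v⟫ - ⟪v, A v⟫ / 2 with hF
  have hadd : Tendsto (fun v => y + v) (𝓝 0) (𝓝 y) := by
    simpa using (continuous_const_add y).tendsto 0
  have hFderiv : ∀ᶠ v in 𝓝 (0 : E),
      HasFDerivAt F (innerSL ℝ (gradient ψ (y + v) - gradient ψ y - A v)) v := by
    filter_upwards [hadd.eventually hψ] with v hv
    have hψv : HasFDerivAt (fun v => ψ (y + v)) (innerSL ℝ (gradient ψ (y + v))) v :=
      (hasFDerivAt_comp_add_left y).2 hv.hasGradientAt.hasFDerivAt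
    simp only [map_sub]
    exact ((hψv.sub_const _).sub (innerSL ℝ (gradient ψ y)).hasFDerivAt).sub
      (hasFDerivAt_inner_self_apply_div_two (isSymmetric_of_hasFDerivAt_gradient hψ hA) v)
  refine Asymptotics.isLittleO_iff.2 fun c hc => ?_
  have hgrad : ∀ᶠ v in 𝓝 (0 : E), ‖gradient ψ (y + v) - gradient ψ y - A v‖ ≤ c * ‖v‖ :=
    (hasFDerivAt_iff_isLittleO_nhds_zero.1 hA).bound hc
  obtain ⟨δ, hδ, hball⟩ := Metric.eventually_nhds_iff_ball.1 (hFderiv.and hgrad)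
  filter_upwards [Metric.ball_mem_nhds 0 hδ] with v hv
  have hsub : Metric.closedBall (0 : E) ‖v‖ ⊆ Metric.ball 0 δ :=
    Metric.closedBall_subset_ball (by simpa using hv)
  have hmvt : ‖F v - F 0‖ ≤ c * ‖v‖ * ‖v - 0‖ := by
    refine (convex_closedBall (0 : E) ‖v‖).norm_image_sub_le_of_norm_hasFDerivWithin_le
      (fun u hu => (hball u (hsub hu)).1.hasFDerivWithinAt) (fun u hu => ?_) (by simp) (by simp)
    rw [innerSL_apply_norm]
    exact (hball u (hsub hu)).2.trans (by gcongr; simpa using hu)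
  simpa [hF, mul_assoc, sq] using hmvt

theorem quadratic_le_taylor_gradient {H : E → E →L[ℝ] E} (hψ : Differentiable ℝ ψ)
    (hH : ∀ z, HasFDerivAt (gradient ψ) (H z) z) (hm : ∀ z v, m * ‖v‖ ^ 2 ≤ ⟪v, H z v⟫)
    (y v : E) : m / 2 * ‖v‖ ^ 2 ≤ ψ (y + v) - ψ y - ⟪gradient ψ y, v⟫ := by
  have hline (s : ℝ) : HasDerivAt (fun s : ℝ => y + s • v) v s := by
    simpa using ((hasDerivAt_id s).smul_const v).const_add y
  have hderiv (s : ℝ) : HasDerivAt (fun s : ℝ => ψ (y + s • v) - m / 2 * ‖v‖ ^ 2 * s ^ 2)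
      (⟪gradient ψ (y + s • v), v⟫ - m * ‖v‖ ^ 2 * s) s := by
    have hψs : HasDerivAt (fun s : ℝ => ψ (y + s • v)) ⟪gradient ψ (y + s • v), v⟫ s :=
      (hψ _).hasGradientAt.hasFDerivAt.comp_hasDerivAt s (hline s)
    refine (hψs.sub ((hasDerivAt_pow 2 s).const_mul (m / 2 * ‖v‖ ^ 2))).congr_deriv ?_
    push_cast
    ring
  have hderiv2 (s : ℝ) : HasDerivAt (fun s : ℝ => ⟪gradient ψ (y + s • v), v⟫ - m * ‖v‖ ^ 2 * s)
      (⟪v, H (y + s • v) v⟫ - m * ‖v‖ ^ 2) s := by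
    have hgrad := ((hH _).comp_hasDerivAt s (hline s)).inner ℝ (hasDerivAt_const s v)
    refine (hgrad.sub ((hasDerivAt_id s).const_mul (m * ‖v‖ ^ 2))).congr_deriv ?_
    simp [real_inner_comm]
  have hconvex : ConvexOn ℝ Set.univ fun s : ℝ => ψ (y + s • v) - m / 2 * ‖v‖ ^ 2 * s ^ 2 :=
    convexOn_of_hasDerivWithinAt2_nonneg convex_univ
      (fun s _ => (hderiv s).continuousAt.continuousWithinAt)
      (fun s _ => (hderiv s).hasDerivWithinAt) (fun s _ => (hderiv2 s).hasDerivWithinAt)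
      (fun s _ => sub_nonneg.2 (hm _ _))
  have hslope := hconvex.le_slope_of_hasDerivAt trivial trivial one_pos (hderiv 0)
  simp only [slope_def_field, zero_smul, one_smul, add_zero, mul_zero, mul_one, sub_zero, div_one,
    one_pow, ne_eq, OfNat.ofNat_ne_zero, not_false_eq_true, zero_pow] at hslope
  linarith

end SecondOrderExpansion

section Gaussian

variable {E : Type*} [NormedAddCommGroup E] [InnerProductSpace ℝ E] {m : ℝ}

theorem inner_sub_le_of_quadratic_le (hm : 0 < m) {q : ℝ} {v : E} (hq : m / 2 * ‖v‖ ^ 2 ≤ q)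
    (u : E) : ⟪u, v⟫ - q ≤ (‖u‖ + 1) ^ 2 / (2 * m) - ‖v‖ := by
  have hsq : (‖u‖ + 1) ^ 2 / (2 * m) - (‖u‖ + 1) * ‖v‖ + m / 2 * ‖v‖ ^ 2 =
      (‖u‖ + 1 - m * ‖v‖) ^ 2 / (2 * m) := by
    field
  have hsq_nonneg : 0 ≤ (‖u‖ + 1 - m * ‖v‖) ^ 2 / (2 * m) := by positivity
  linarith [real_inner_le_norm u v]

theorem exp_inner_sub_le_of_quadratic_le (hm : 0 < m) {q : ℝ} {v : E}
    (hq : m / 2 * ‖v‖ ^ 2 ≤ q) (u : E) :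
    exp (⟪u, v⟫ - q) ≤ exp ((‖u‖ + 1) ^ 2 / (2 * m)) * exp (-‖v‖) := by
  rw [← exp_add]
  exact exp_le_exp.2 (inner_sub_le_of_quadratic_le hm hq u)

theorem det_ne_zero_of_quadratic_le [FiniteDimensional ℝ E] {A : E →L[ℝ] E} (hm : 0 < m)
    (hA : ∀ v, m * ‖v‖ ^ 2 ≤ ⟪v, A v⟫) : A.det ≠ 0 := by
  refine fun hdet => (LinearMap.bot_lt_ker_of_det_eq_zero hdet).ne' (LinearMap.ker_eq_bot'.2 ?_)
  intro v hv
  have hv' : A v = 0 := hv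
  have hle := hA v
  rw [hv', inner_zero_right] at hle
  simpa using nonpos_of_mul_nonpos_right hle hm

variable [MeasurableSpace E] {A : E →L[ℝ] E}

/-- The Laplace transform of the (unnormalised) centred Gaussian weight with precision
operator `A`. -/
noncomputable def gaussianLaplace (μ : Measure E) (A : E →L[ℝ] E) (u : E) : ℝ :=
  ∫ v, exp (⟪u, v⟫ - ⟪v, A v⟫ / 2) ∂μ

variable [BorelSpace E] {μ : Measure E}

-- Completing the square: `⟪A w, v⟫ - ⟪v, A v⟫ / 2 = ⟪w, A w⟫ / 2 - ⟪v - w, A (v - w)⟫ / 2`.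
theorem gaussianLaplace_apply [μ.IsAddLeftInvariant] (hA : (A : E →ₗ[ℝ] E).IsSymmetric) (w : E) :
    gaussianLaplace μ A (A w) = exp (⟪w, A w⟫ / 2) * gaussianLaplace μ A 0 := by
  rw [gaussianLaplace, gaussianLaplace, ← integral_const_mul, ← integral_add_left_eq_self _ w]
  refine integral_congr_ae (ae_of_all _ fun v => ?_)
  have hsymm : ⟪w, A v⟫ = ⟪v, A w⟫ := by
    rw [real_inner_comm]
    exact hA v w
  simp only [← exp_add, inner_add_left, inner_add_right, map_add, inner_zero_left,
    real_inner_comm _ (A w), hsymm]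
  ring_nf

variable [FiniteDimensional ℝ E] [μ.IsAddHaarMeasure]

theorem integrable_exp_inner_sub {q : E → ℝ} (hm : 0 < m) (hq : AEStronglyMeasurable q μ)
    (hle : ∀ v, m / 2 * ‖v‖ ^ 2 ≤ q v) (u : E) :
    Integrable (fun v => exp (⟪u, v⟫ - q v)) μ := by
  refine (integrable_exp_neg_norm.const_mul (exp ((‖u‖ + 1) ^ 2 / (2 * m)))).mono'
    (continuous_exp.comp_aestronglyMeasurable
      ((Continuous.aestronglyMeasurable (by fun_prop)).sub hq)) (ae_of_all _ fun v => ?_)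
  rw [norm_of_nonneg (exp_pos _).le]
  exact exp_inner_sub_le_of_quadratic_le hm (hle v) u

theorem integral_eq_abs_det_smul_integral_comp {F : Type*} [NormedAddCommGroup F] [NormedSpace ℝ F]
    (A : E →L[ℝ] E) (hA : A.det ≠ 0) (G : E → F) :
    ∫ u, G u ∂μ = |A.det| • ∫ w, G (A w) ∂μ := by
  have hbij : Function.Bijective A := (LinearMap.equivOfDetNeZero (A : E →ₗ[ℝ] E) hA).bijective
  have himage := integral_image_eq_integral_abs_det_fderiv_smul μ MeasurableSet.univ
    (fun w _ => A.hasFDerivAt.hasFDerivWithinAt) hbij.injective.injOn G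
  rwa [Set.image_univ_of_surjective hbij.surjective, setIntegral_univ, setIntegral_univ,
    integral_smul] at himage

theorem gaussianLaplace_pos (hm : 0 < m) (hA : ∀ v, m * ‖v‖ ^ 2 ≤ ⟪v, A v⟫) (u : E) :
    0 < gaussianLaplace μ A u :=
  integral_exp_pos (integrable_exp_inner_sub hm (Continuous.aestronglyMeasurable (by fun_prop))
    (fun v => by linarith [hA v]) u)

theorem integral_inv_gaussianLaplace (hm : 0 < m) (hA : ∀ v, m * ‖v‖ ^ 2 ≤ ⟪v, A v⟫)
    (hsymm : (A : E →ₗ[ℝ] E).IsSymmetric) : ∫ u, (gaussianLaplace μ A u)⁻¹ ∂μ = |A.det| := by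
  have hinv (w : E) : (gaussianLaplace μ A (A w))⁻¹ =
      exp (⟪0, w⟫ - ⟪w, A w⟫ / 2) * (gaussianLaplace μ A 0)⁻¹ := by
    rw [gaussianLaplace_apply hsymm, mul_inv, ← exp_neg, inner_zero_left, zero_sub]
  rw [integral_eq_abs_det_smul_integral_comp A (det_ne_zero_of_quadratic_le hm hA)]
  simp only [hinv]
  rw [integral_mul_const]
  exact (mul_eq_left₀ (by simpa using det_ne_zero_of_quadratic_le hm hA)).2
    (mul_inv_cancel₀ (gaussianLaplace_pos hm hA 0).ne')

end Gaussian

section QuadraticWell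

theorem measureReal_ball_pos {α : Type*} [PseudoMetricSpace α] [ProperSpace α] [MeasurableSpace α]
    (μ : Measure α) [μ.IsOpenPosMeasure] [IsFiniteMeasureOnCompacts μ] (x : α) {r : ℝ}
    (hr : 0 < r) : 0 < μ.real (Metric.ball x r) :=
  ENNReal.toReal_pos (Metric.measure_ball_pos μ x hr).ne' measure_ball_lt_top.ne

variable {E : Type*} [NormedAddCommGroup E] [InnerProductSpace ℝ E]

/-- A potential with a nondegenerate minimum at the origin: it dominates the quadratic
`m / 2 * ‖v‖ ^ 2` everywhere and has the second-order expansion `⟪v, A v⟫ / 2` at the origin.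
This is all the Laplace method needs to know about the potential; no derivative is required to
exist away from the origin. -/
structure IsQuadraticWell [MeasurableSpace E] (φ : E → ℝ) (A : E →L[ℝ] E) (m : ℝ) : Prop where
  pos : 0 < m
  measurable : Measurable φ
  isSymmetric : (A : E →ₗ[ℝ] E).IsSymmetric
  quadratic_le : ∀ v, m / 2 * ‖v‖ ^ 2 ≤ φ v
  isLittleO : (fun v => φ v - ⟪v, A v⟫ / 2) =o[𝓝 0] fun v => ‖v‖ ^ 2

/-- The exponential weight of the potential `φ` at temperature `t ^ 2`, in coordinates blown up by
`t⁻¹` and tilted by `u`. -/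
noncomputable def rescaledKernel (φ : E → ℝ) (t : ℝ) (u v : E) : ℝ :=
  exp (⟪u, v⟫ - φ (t • v) / t ^ 2)

theorem rescaledKernel_nonneg (φ : E → ℝ) (t : ℝ) (u v : E) : 0 ≤ rescaledKernel φ t u v :=
  (exp_pos _).le

/-- The Laplace transform, in blown-up coordinates, of the exponential weight of `φ` at
temperature `t ^ 2` against the density `w`. -/
noncomputable def rescaledLaplace [MeasurableSpace E] (μ : Measure E) (φ w : E → ℝ) (t : ℝ)
    (u : E) : ℝ :=
  ∫ v, rescaledKernel φ t u v * w (t • v) ∂μ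

theorem half_mul_norm_le_inner_of_mem_ball {u v : E} {r : ℝ}
    (hv : v ∈ Metric.ball (r • ‖u‖⁻¹ • u) (r / 2)) : r * ‖u‖ / 2 ≤ ⟪u, v⟫ := by
  have hdist : ‖r • ‖u‖⁻¹ • u - v‖ ≤ r / 2 := by
    rw [← dist_eq_norm, dist_comm]
    exact (Metric.mem_ball.1 hv).le
  have hcenter : ⟪u, r • ‖u‖⁻¹ • u⟫ = r * ‖u‖ := by
    rw [inner_smul_right, inner_smul_right, real_inner_self_eq_norm_sq, sq,
      ← mul_assoc ‖u‖⁻¹, inv_mul_mul_self]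
  have hcauchy : ⟪u, r • ‖u‖⁻¹ • u - v⟫ ≤ ‖u‖ * (r / 2) :=
    (real_inner_le_norm _ _).trans (by gcongr)
  rw [inner_sub_right, hcenter] at hcauchy
  linarith

theorem norm_le_two_mul_of_mem_ball {u v : E} {r : ℝ} (hr : 0 ≤ r)
    (hv : v ∈ Metric.ball (r • ‖u‖⁻¹ • u) (r / 2)) : ‖v‖ ≤ 2 * r := by
  have hcenter : ‖r • ‖u‖⁻¹ • u‖ ≤ r := by
    rw [norm_smul, norm_of_nonneg hr, norm_smul, norm_inv, norm_norm]
    exact mul_le_of_le_one_right hr inv_mul_le_one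
  have htriangle := norm_le_norm_add_norm_sub' v (r • ‖u‖⁻¹ • u)
  have hdist := Metric.mem_ball.1 hv
  rw [dist_eq_norm] at hdist
  linarith

namespace IsQuadraticWell

variable [MeasurableSpace E] {φ w : E → ℝ} {A : E →L[ℝ] E} {m : ℝ}

theorem quadratic_le_comp_smul_div_sq (hφ : IsQuadraticWell φ A m) {t : ℝ} (ht : t ≠ 0) (v : E) :
    m / 2 * ‖v‖ ^ 2 ≤ φ (t • v) / t ^ 2 := by
  rw [le_div_iff₀ (by positivity)]
  have hle := hφ.quadratic_le (t • v)
  rwa [norm_smul, mul_pow, norm_eq_abs, sq_abs, mul_comm (t ^ 2), ← mul_assoc] at hle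

theorem tendsto_comp_smul_div_sq (hφ : IsQuadraticWell φ A m) (v : E) :
    Tendsto (fun t : ℝ => φ (t • v) / t ^ 2) (𝓝[>] 0) (𝓝 (⟪v, A v⟫ / 2)) := by
  have hsmul : Tendsto (fun t : ℝ => t • v) (𝓝[>] 0) (𝓝 0) := by
    simpa using (tendsto_id.smul_const v).mono_left (nhdsWithin_le_nhds (a := (0 : ℝ)))
  have hlittle : (fun t : ℝ => φ (t • v) - ⟪t • v, A (t • v)⟫ / 2) =o[𝓝[>] 0] fun t => t ^ 2 := by
    refine (hφ.isLittleO.comp_tendsto hsmul).trans_isBigO ?_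
    refine Asymptotics.IsBigO.of_bound (‖v‖ ^ 2) (Eventually.of_forall fun t => ?_)
    simp [norm_smul, mul_pow, mul_comm]
  have hlim := hlittle.tendsto_div_nhds_zero.add_const (⟪v, A v⟫ / 2)
  rw [zero_add] at hlim
  refine hlim.congr' ?_
  filter_upwards [self_mem_nhdsWithin] with t (ht : 0 < t)
  rw [map_smul, inner_smul_left, inner_smul_right, RCLike.conj_to_real]
  field

theorem quadratic_le_inner (hφ : IsQuadraticWell φ A m) (v : E) : m * ‖v‖ ^ 2 ≤ ⟪v, A v⟫ := by
  have hlim : m / 2 * ‖v‖ ^ 2 ≤ ⟪v, A v⟫ / 2 := by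
    refine ge_of_tendsto (hφ.tendsto_comp_smul_div_sq v) ?_
    filter_upwards [self_mem_nhdsWithin] with t (ht : 0 < t)
      using hφ.quadratic_le_comp_smul_div_sq ht.ne' v
  linarith

theorem eventually_le_quadratic (hφ : IsQuadraticWell φ A m) :
    ∀ᶠ v in 𝓝 0, φ v ≤ (‖A‖ / 2 + 1) * ‖v‖ ^ 2 := by
  filter_upwards [hφ.isLittleO.bound one_pos] with v hv
  have hA : ⟪v, A v⟫ ≤ ‖v‖ * (‖A‖ * ‖v‖) :=
    (real_inner_le_norm _ _).trans (by gcongr; exact A.le_opNorm v)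
  have hremainder := (le_abs_self _).trans hv
  rw [one_mul, norm_of_nonneg (by positivity)] at hremainder
  linarith

theorem rescaledKernel_le (hφ : IsQuadraticWell φ A m) {t : ℝ} (ht : t ≠ 0) (u v : E) :
    rescaledKernel φ t u v ≤ exp ((‖u‖ + 1) ^ 2 / (2 * m)) * exp (-‖v‖) :=
  exp_inner_sub_le_of_quadratic_le hφ.pos (hφ.quadratic_le_comp_smul_div_sq ht v) u

theorem tendsto_rescaledKernel (hφ : IsQuadraticWell φ A m) (u v : E) :
    Tendsto (fun t => rescaledKernel φ t u v) (𝓝[>] 0) (𝓝 (exp (⟪u, v⟫ - ⟪v, A v⟫ / 2))) :=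
  (continuous_exp.tendsto _).comp ((hφ.tendsto_comp_smul_div_sq v).const_sub _)

theorem exists_le_rescaledKernel_mul (hφ : IsQuadraticWell φ A m) (hwc : ContinuousAt w 0)
    (hw0 : 0 < w 0) : ∃ c > 0, ∃ M, ∃ δ > 0, ∀ t > 0, ∀ r > 0, r * t ≤ δ →
      ∀ u, ∀ v ∈ Metric.ball (r • ‖u‖⁻¹ • u) (r / 2),
        c * exp (r * ‖u‖ / 2 - M * r ^ 2) ≤ rescaledKernel φ t u v * w (t • v) := by
  obtain ⟨δ, hδ, hball⟩ := Metric.eventually_nhds_iff_ball.1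
    (hφ.eventually_le_quadratic.and (hwc.eventually_const_lt (half_lt_self hw0)))
  refine ⟨w 0 / 2, by positivity, (‖A‖ / 2 + 1) * 4, δ / 4, by positivity,
    fun t ht r hr hrt u v hv => ?_⟩
  have hv_le : ‖v‖ ≤ 2 * r := norm_le_two_mul_of_mem_ball hr.le hv
  have htv : ‖t • v‖ = t * ‖v‖ := by rw [norm_smul, norm_of_nonneg ht.le]
  have hmem : t • v ∈ Metric.ball 0 δ := by
    rw [mem_ball_zero_iff, htv]
    calc t * ‖v‖ ≤ t * (2 * r) := by gcongr
      _ < δ := by linarith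
  obtain ⟨hφ_le, hw_ge⟩ := hball _ hmem
  have hφ_div : φ (t • v) / t ^ 2 ≤ (‖A‖ / 2 + 1) * 4 * r ^ 2 :=
    calc φ (t • v) / t ^ 2 ≤ (‖A‖ / 2 + 1) * ‖v‖ ^ 2 := by
          rw [div_le_iff₀ (by positivity), mul_assoc, mul_comm (‖v‖ ^ 2), ← mul_pow, ← htv]
          exact hφ_le
      _ ≤ (‖A‖ / 2 + 1) * (2 * r) ^ 2 := by gcongr
      _ = (‖A‖ / 2 + 1) * 4 * r ^ 2 := by ring
  rw [mul_comm, rescaledKernel]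
  gcongr
  exact half_mul_norm_le_inner_of_mem_ball hv

variable [BorelSpace E] [FiniteDimensional ℝ E]

theorem measurable_rescaledKernel (hφ : IsQuadraticWell φ A m) (t : ℝ) :
    Measurable fun p : E × E => rescaledKernel φ t p.1 p.2 := by
  have hmeas : Measurable fun p : E × E => φ (t • p.2) :=
    hφ.measurable.comp (measurable_snd.const_smul t)
  exact ((measurable_fst.inner measurable_snd).sub (hmeas.div_const _)).exp

variable {μ : Measure E} [μ.IsAddHaarMeasure]

theorem integrable_rescaledKernel_mul (hφ : IsQuadraticWell φ A m) (hw : Integrable w μ)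
    {t : ℝ} (ht : t ≠ 0) (u : E) : Integrable (fun v => rescaledKernel φ t u v * w (t • v)) μ := by
  refine (hw.comp_smul ht).bdd_mul
    ((hφ.measurable_rescaledKernel t).comp measurable_prodMk_left).aestronglyMeasurable
    (ae_of_all _ fun v => (?_ : _ ≤ exp ((‖u‖ + 1) ^ 2 / (2 * m))))
  rw [norm_of_nonneg (rescaledKernel_nonneg φ t u v)]
  refine (hφ.rescaledKernel_le ht u v).trans (mul_le_of_le_one_right (exp_pos _).le ?_)
  exact exp_le_one_iff.2 (neg_nonpos.2 (norm_nonneg v))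

theorem aestronglyMeasurable_rescaledLaplace (hφ : IsQuadraticWell φ A m)
    (hw : AEStronglyMeasurable w μ) {t : ℝ} (ht : t ≠ 0) :
    AEStronglyMeasurable (rescaledLaplace μ φ w t) μ := by
  have hwt : AEStronglyMeasurable (fun v => w (t • v)) μ :=
    hw.comp_quasiMeasurePreserving (Measure.quasiMeasurePreserving_smul μ ht)
  exact ((hφ.measurable_rescaledKernel t).aestronglyMeasurable.mul
    hwt.comp_snd).integral_prod_right'

theorem tendsto_rescaledLaplace (hφ : IsQuadraticWell φ A m) (hw : Integrable w μ)
    (hwc : ContinuousAt w 0) (u : E) :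
    Tendsto (fun t => rescaledLaplace μ φ w t u) (𝓝[>] 0) (𝓝 (gaussianLaplace μ A u * w 0)) := by
  refine tendsto_integral_smul_comp_smul (h := fun t => rescaledKernel φ t u)
    (H := fun v => exp ((‖u‖ + 1) ^ 2 / (2 * m)) * exp (-‖v‖)) ?_ ?_
    (integrable_exp_neg_norm.const_mul _) ?_ (hφ.tendsto_rescaledKernel u)
    (gaussianLaplace_pos hφ.pos hφ.quadratic_le_inner u) hw hwc
  · exact Eventually.of_forall fun t =>
      ((hφ.measurable_rescaledKernel t).comp measurable_prodMk_left).aestronglyMeasurable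
  · filter_upwards [self_mem_nhdsWithin] with t (ht : 0 < t) v
    exact ⟨rescaledKernel_nonneg φ t u v, hφ.rescaledKernel_le ht.ne' u v⟩
  · simpa only [mul_left_comm, mul_zero] using
      (tendsto_pow_norm_mul_exp_neg_norm_cobounded _).const_mul (exp ((‖u‖ + 1) ^ 2 / (2 * m)))

-- The tilt by `u` moves mass in the direction of `u`, hence the ball centred at distance `r` from
-- the origin in that direction.
theorem exists_le_rescaledLaplace (hφ : IsQuadraticWell φ A m) (hw : Integrable w μ)
    (hwc : ContinuousAt w 0) (hw_nonneg : 0 ≤ w) (hw0 : 0 < w 0) :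
    ∃ c > 0, ∃ M, ∃ δ > 0, ∀ t > 0, ∀ r > 0, r * t ≤ δ → ∀ u,
      μ.real (Metric.ball 0 (r / 2)) * (c * exp (r * ‖u‖ / 2 - M * r ^ 2)) ≤
        rescaledLaplace μ φ w t u := by
  obtain ⟨c, hc, M, δ, hδ, hle⟩ := hφ.exists_le_rescaledKernel_mul hwc hw0
  refine ⟨c, hc, M, δ, hδ, fun t ht r hr hrt u => ?_⟩
  have hint := hφ.integrable_rescaledKernel_mul hw ht.ne' u
  rw [measureReal_def, ← Measure.addHaar_ball_center μ (r • ‖u‖⁻¹ • u), ← measureReal_def]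
  calc μ.real (Metric.ball (r • ‖u‖⁻¹ • u) (r / 2)) * (c * exp (r * ‖u‖ / 2 - M * r ^ 2))
      = ∫ _ in Metric.ball (r • ‖u‖⁻¹ • u) (r / 2), c * exp (r * ‖u‖ / 2 - M * r ^ 2) ∂μ := by
        rw [setIntegral_const, smul_eq_mul]
    _ ≤ ∫ v in Metric.ball (r • ‖u‖⁻¹ • u) (r / 2), rescaledKernel φ t u v * w (t • v) ∂μ :=
        setIntegral_mono_on (integrableOn_const measure_ball_lt_top.ne) hint.integrableOn
          measurableSet_ball (hle t ht r hr hrt u)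
    _ ≤ rescaledLaplace μ φ w t u :=
        setIntegral_le_integral hint
          (ae_of_all _ fun v => mul_nonneg (rescaledKernel_nonneg φ t u v) (hw_nonneg (t • v)))

theorem exists_forall_le_rescaledLaplace (hφ : IsQuadraticWell φ A m) (hw : Integrable w μ)
    (hwc : ContinuousAt w 0) (hw_nonneg : 0 ≤ w) (hw0 : 0 < w 0) {t : ℝ} (ht : 0 < t) :
    ∃ c > 0, ∀ u, c ≤ rescaledLaplace μ φ w t u := by
  obtain ⟨c, hc, M, δ, hδ, hle⟩ := hφ.exists_le_rescaledLaplace hw hwc hw_nonneg hw0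
  have hball := measureReal_ball_pos μ (0 : E) (by positivity : 0 < δ / t / 2)
  refine ⟨μ.real (Metric.ball (0 : E) (δ / t / 2)) * (c * exp (0 - M * (δ / t) ^ 2)),
    by positivity, fun u => le_trans ?_
      (hle t ht (δ / t) (by positivity) (div_mul_cancel₀ δ ht.ne').le u)⟩
  gcongr
  positivity

theorem exists_eventually_exp_norm_le_rescaledLaplace (hφ : IsQuadraticWell φ A m)
    (hw : Integrable w μ) (hwc : ContinuousAt w 0) (hw_nonneg : 0 ≤ w) (hw0 : 0 < w 0) :
    ∃ c > 0, ∀ᶠ t in 𝓝[>] 0, ∀ u, c * exp ‖u‖ ≤ rescaledLaplace μ φ w t u := by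
  obtain ⟨c, hc, M, δ, hδ, hle⟩ := hφ.exists_le_rescaledLaplace hw hwc hw_nonneg hw0
  have hball := measureReal_ball_pos μ (0 : E) (half_pos (two_pos (α := ℝ)))
  refine ⟨μ.real (Metric.ball (0 : E) (2 / 2)) * (c * exp (-(M * 2 ^ 2))), by positivity, ?_⟩
  filter_upwards [Ioc_mem_nhdsGT (half_pos hδ)] with t ht u
  have hbound := hle t ht.1 2 two_pos (by linarith [ht.2]) u
  rwa [mul_div_cancel_left₀ _ two_ne_zero, sub_eq_neg_add, exp_add, ← mul_assoc c,
    ← mul_assoc] at hbound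

theorem rescaledLaplace_pos (hφ : IsQuadraticWell φ A m) (hw : Integrable w μ)
    (hwc : ContinuousAt w 0) (hw_nonneg : 0 ≤ w) (hw0 : 0 < w 0) {t : ℝ} (ht : 0 < t) (u : E) :
    0 < rescaledLaplace μ φ w t u := by
  obtain ⟨c, hc, hle⟩ := hφ.exists_forall_le_rescaledLaplace hw hwc hw_nonneg hw0 ht
  exact hc.trans_le (hle u)

theorem integrable_inv_rescaledLaplace_mul (hφ : IsQuadraticWell φ A m) (hw : Integrable w μ)
    (hwc : ContinuousAt w 0) (hw_nonneg : 0 ≤ w) (hw0 : 0 < w 0) {w' : E → ℝ}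
    (hw' : Integrable w' μ) {t : ℝ} (ht : 0 < t) :
    Integrable (fun u => (rescaledLaplace μ φ w t u)⁻¹ * w' (t • u)) μ := by
  obtain ⟨c, hc, hle⟩ := hφ.exists_forall_le_rescaledLaplace hw hwc hw_nonneg hw0 ht
  refine (hw'.comp_smul ht.ne').bdd_mul
    (hφ.aestronglyMeasurable_rescaledLaplace hw.aestronglyMeasurable ht.ne').inv₀
    (ae_of_all _ fun u => (?_ : _ ≤ c⁻¹))
  rw [norm_inv, norm_of_nonneg (hc.le.trans (hle u))]
  exact inv_anti₀ hc (hle u)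

theorem tendsto_integral_inv_rescaledLaplace_mul (hφ : IsQuadraticWell φ A m)
    (hw : Integrable w μ) (hwc : ContinuousAt w 0) (hw_nonneg : 0 ≤ w) (hw0 : 0 < w 0)
    {w' : E → ℝ} (hw' : Integrable w' μ) (hwc' : ContinuousAt w' 0) :
    Tendsto (fun t => ∫ u, (rescaledLaplace μ φ w t u)⁻¹ * w' (t • u) ∂μ) (𝓝[>] 0)
      (𝓝 (|A.det| * (w 0)⁻¹ * w' 0)) := by
  obtain ⟨c, hc, hle⟩ := hφ.exists_eventually_exp_norm_le_rescaledLaplace hw hwc hw_nonneg hw0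
  have hmass : ∫ u, (gaussianLaplace μ A u * w 0)⁻¹ ∂μ = |A.det| * (w 0)⁻¹ := by
    simp only [mul_inv, integral_mul_const,
      integral_inv_gaussianLaplace hφ.pos hφ.quadratic_le_inner hφ.isSymmetric]
  have hdet : A.det ≠ 0 := det_ne_zero_of_quadratic_le hφ.pos hφ.quadratic_le_inner
  rw [← hmass]
  refine tendsto_integral_smul_comp_smul (h := fun t u => (rescaledLaplace μ φ w t u)⁻¹)
    (H := fun u => c⁻¹ * exp (-‖u‖)) ?_ ?_ (integrable_exp_neg_norm.const_mul _) ?_ (fun u => ?_)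
    (by rw [hmass]; positivity) hw' hwc'
  · filter_upwards [self_mem_nhdsWithin] with t (ht : 0 < t)
      using (hφ.aestronglyMeasurable_rescaledLaplace hw.aestronglyMeasurable ht.ne').inv₀
  · filter_upwards [hle, self_mem_nhdsWithin] with t ht (htpos : 0 < t) u
    refine ⟨inv_nonneg.2 (hφ.rescaledLaplace_pos hw hwc hw_nonneg hw0 htpos u).le, ?_⟩
    rw [exp_neg, ← mul_inv]
    exact inv_anti₀ (by positivity) (ht u)
  · simpa only [mul_left_comm, mul_zero] using
      (tendsto_pow_norm_mul_exp_neg_norm_cobounded _).const_mul c⁻¹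
  · have hG := gaussianLaplace_pos (μ := μ) hφ.pos hφ.quadratic_le_inner u
    exact (hφ.tendsto_rescaledLaplace hw hwc u).inv₀ (mul_pos hG hw0).ne'

end IsQuadraticWell

end QuadraticWell

section LocalDensity

variable {E : Type*} [NormedAddCommGroup E] {Y : Set E} {g : E → ℝ} {y : E}

/-- The density `exp (-g)` on `Y`, extended by `0` and translated so that `y` sits at the
origin. -/
noncomputable def localDensity (Y : Set E) (g : E → ℝ) (y v : E) : ℝ :=
  Y.indicator (fun z => exp (-g z)) (y + v)

theorem localDensity_nonneg (Y : Set E) (g : E → ℝ) (y : E) : 0 ≤ localDensity Y g y :=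
  fun _ => Set.indicator_nonneg (fun _ _ => (exp_pos _).le) _

theorem localDensity_zero (hy : y ∈ Y) : localDensity Y g y 0 = exp (-g y) := by
  rw [localDensity, add_zero, Set.indicator_of_mem hy]

theorem continuousAt_localDensity_zero (hy : y ∈ interior Y) (hg : ContinuousAt g y) :
    ContinuousAt (localDensity Y g y) 0 := by
  have hadd : Tendsto (fun v => y + v) (𝓝 0) (𝓝 y) := by
    simpa using (continuous_const_add y).tendsto 0
  have hexp : Tendsto (fun z => exp (-g z)) (𝓝 y) (𝓝 (localDensity Y g y 0)) := by
    rw [localDensity_zero (interior_subset hy)]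
    exact hg.neg.rexp
  refine (hexp.congr' ?_).comp hadd
  filter_upwards [mem_interior_iff_mem_nhds.1 hy] with z hz
  rw [Set.indicator_of_mem hz]

theorem integrable_localDensity [MeasurableSpace E] [BorelSpace E] {μ : Measure E}
    [μ.IsAddLeftInvariant] (hY : MeasurableSet Y)
    (hg : IntegrableOn (fun z => exp (-g z)) Y μ) : Integrable (localDensity Y g y) μ :=
  (hg.integrable_indicator hY).comp_add_left y

end LocalDensity

section Sinkhorn

theorem setIntegral_pos_of_forall_pos {α : Type*} [TopologicalSpace α] [MeasurableSpace α]
    {μ : Measure α} [μ.IsOpenPosMeasure] {s : Set α} {F : α → ℝ} (hs : (interior s).Nonempty)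
    (hpos : ∀ x, 0 < F x) (hF : IntegrableOn F s μ) : 0 < ∫ x in s, F x ∂μ := by
  rw [integral_pos_iff_support_of_nonneg (fun x => (hpos x).le) hF,
    Function.support_eq_univ fun x => (hpos x).ne', Measure.restrict_apply_univ]
  exact Measure.measure_pos_of_nonempty_interior μ hs

/-- The excess of `ψ` at `y + v` over the affine function of slope `p` agreeing with `ψ` at `y`; for
`p = ∇ψ(y)` this is the Bregman divergence of `ψ`. -/
noncomputable def affineRemainder {E : Type*} [NormedAddCommGroup E] [InnerProductSpace ℝ E]
    (ψ : E → ℝ) (p y v : E) : ℝ :=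
  ψ (y + v) - ψ y - ⟪p, v⟫

variable {d : ℕ} {X Y : Set (EuclideanSpace ℝ (Fin d))} {f g ψ : EuclideanSpace ℝ (Fin d) → ℝ}
  {p y : EuclideanSpace ℝ (Fin d)} {t : ℝ}

theorem indicator_sinkhornInner_add_smul (Y : Set (EuclideanSpace ℝ (Fin d)))
    (g ψ : EuclideanSpace ℝ (Fin d) → ℝ) (p x y v : EuclideanSpace ℝ (Fin d)) (ht : t ≠ 0) :
    Y.indicator (sinkhornInner g (t ^ 2) ψ x) (y + t • v) =
      exp ((⟪x, y⟫ - ψ y) / t ^ 2) *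
        (rescaledKernel (affineRemainder ψ p y) t (t⁻¹ • (x - p)) v *
          localDensity Y g y (t • v)) := by
  have hexp : sinkhornInner g (t ^ 2) ψ x (y + t • v) =
      exp ((⟪x, y⟫ - ψ y) / t ^ 2) *
        rescaledKernel (affineRemainder ψ p y) t (t⁻¹ • (x - p)) v * exp (-g (y + t • v)) := by
    rw [sinkhornInner, rescaledKernel, affineRemainder, ← exp_add, ← exp_add]
    simp only [inner_add_right, inner_smul_right, real_inner_smul_left, inner_sub_left]
    congr 1
    field
  by_cases hmem : y + t • v ∈ Y
  · rw [localDensity, Set.indicator_of_mem hmem, Set.indicator_of_mem hmem, hexp, mul_assoc]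
  · simp only [localDensity, Set.indicator_of_notMem hmem, mul_zero]

theorem setIntegral_sinkhornInner (hY : MeasurableSet Y) (ht : 0 < t)
    (p x : EuclideanSpace ℝ (Fin d)) :
    ∫ y' in Y, sinkhornInner g (t ^ 2) ψ x y' = t ^ d * (exp ((⟪x, y⟫ - ψ y) / t ^ 2) *
      rescaledLaplace volume (affineRemainder ψ p y) (localDensity Y g y) t (t⁻¹ • (x - p))) := by
  rw [← integral_indicator hY, integral_eq_pow_smul_integral_comp_add_smul _ y ht,
    finrank_euclideanSpace_fin, smul_eq_mul]
  simp only [indicator_sinkhornInner_add_smul Y g ψ p x y _ ht.ne', integral_const_mul,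
    rescaledLaplace]

theorem indicator_sinkhornOuter_add_smul (hY : MeasurableSet Y) (ht : 0 < t)
    (u : EuclideanSpace ℝ (Fin d)) :
    X.indicator (sinkhornOuter Y f g (t ^ 2) ψ y) (p + t • u) =
      exp (ψ y / t ^ 2) * (t ^ d)⁻¹ *
        ((rescaledLaplace volume (affineRemainder ψ p y) (localDensity Y g y) t u)⁻¹ *
          localDensity X f p (t • u)) := by
  have hquot : exp (1 / t ^ 2 * ⟪p + t • u, y⟫) /
      ∫ y' in Y, sinkhornInner g (t ^ 2) ψ (p + t • u) y' = exp (ψ y / t ^ 2) * (t ^ d)⁻¹ *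
        (rescaledLaplace volume (affineRemainder ψ p y) (localDensity Y g y) t u)⁻¹ := by
    rw [setIntegral_sinkhornInner (y := y) hY ht p, add_sub_cancel_left, inv_smul_smul₀ ht.ne',
      sub_div, exp_sub, one_div_mul_eq_div]
    field
  by_cases hmem : p + t • u ∈ X
  · rw [localDensity, Set.indicator_of_mem hmem, Set.indicator_of_mem hmem, sinkhornOuter, hquot,
      mul_assoc _ _⁻¹]
  · simp only [localDensity, Set.indicator_of_notMem hmem, mul_zero]

theorem setIntegral_sinkhornOuter (hX : MeasurableSet X) (hY : MeasurableSet Y) (ht : 0 < t)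
    (p : EuclideanSpace ℝ (Fin d)) :
    ∫ x in X, sinkhornOuter Y f g (t ^ 2) ψ y x = exp (ψ y / t ^ 2) *
      ∫ u, (rescaledLaplace volume (affineRemainder ψ p y) (localDensity Y g y) t u)⁻¹ *
        localDensity X f p (t • u) := by
  rw [← integral_indicator hX, integral_eq_pow_smul_integral_comp_add_smul _ p ht,
    finrank_euclideanSpace_fin, smul_eq_mul]
  simp only [indicator_sinkhornOuter_add_smul hY ht, integral_const_mul]
  field

theorem sinkhornStep_sub_div_sq (hX : MeasurableSet X) (hY : MeasurableSet Y) (ht : 0 < t)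
    (p : EuclideanSpace ℝ (Fin d)) (hpos : 0 < ∫ x in X, sinkhornOuter Y f g (t ^ 2) ψ y x) :
    (sinkhornStep X Y f g (t ^ 2) ψ y - ψ y) / t ^ 2 =
      log (∫ u, (rescaledLaplace volume (affineRemainder ψ p y) (localDensity Y g y) t u)⁻¹ *
        localDensity X f p (t • u)) := by
  have heq := setIntegral_sinkhornOuter (f := f) (g := g) (ψ := ψ) (y := y) hX hY ht p
  rw [heq] at hpos
  rw [sinkhornStep, heq, log_mul (exp_pos _).ne' (pos_of_mul_pos_right hpos (exp_pos _).le).ne',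
    log_exp]
  field

variable {A : EuclideanSpace ℝ (Fin d) →L[ℝ] EuclideanSpace ℝ (Fin d)} {m : ℝ}

theorem integrableOn_sinkhornInner (hY : MeasurableSet Y)
    (hg : IntegrableOn (fun z => exp (-g z)) Y)
    (hψ : IsQuadraticWell (affineRemainder ψ p y) A m) (ht : 0 < t)
    (x : EuclideanSpace ℝ (Fin d)) : IntegrableOn (sinkhornInner g (t ^ 2) ψ x) Y := by
  rw [← integrable_indicator_iff hY, ← integrable_comp_add_smul_iff _ y ht.ne']
  simp only [indicator_sinkhornInner_add_smul Y g ψ p x y _ ht.ne']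
  exact (hψ.integrable_rescaledKernel_mul (integrable_localDensity hY hg) ht.ne' _).const_mul _

theorem setIntegral_sinkhornInner_pos (hY : MeasurableSet Y)
    (hg : IntegrableOn (fun z => exp (-g z)) Y) (hyY : y ∈ interior Y)
    (hψ : IsQuadraticWell (affineRemainder ψ p y) A m) (ht : 0 < t)
    (x : EuclideanSpace ℝ (Fin d)) : 0 < ∫ y' in Y, sinkhornInner g (t ^ 2) ψ x y' :=
  setIntegral_pos_of_forall_pos ⟨y, hyY⟩ (fun _ => exp_pos _)
    (integrableOn_sinkhornInner hY hg hψ ht x)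

theorem integrableOn_sinkhornOuter (hX : MeasurableSet X) (hY : MeasurableSet Y)
    (hf : IntegrableOn (fun x => exp (-f x)) X) (hg : IntegrableOn (fun z => exp (-g z)) Y)
    (hψ : IsQuadraticWell (affineRemainder ψ p y) A m) (hyY : y ∈ interior Y)
    (hgc : ContinuousAt g y) (ht : 0 < t) : IntegrableOn (sinkhornOuter Y f g (t ^ 2) ψ y) X := by
  rw [← integrable_indicator_iff hX, ← integrable_comp_add_smul_iff _ p ht.ne']
  simp only [indicator_sinkhornOuter_add_smul hY ht]
  refine (hψ.integrable_inv_rescaledLaplace_mul (integrable_localDensity hY hg)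
    (continuousAt_localDensity_zero hyY hgc) (localDensity_nonneg Y g y) ?_
    (integrable_localDensity hX hf) ht).const_mul _
  rw [localDensity_zero (interior_subset hyY)]
  exact exp_pos _

theorem setIntegral_sinkhornOuter_pos (hX : MeasurableSet X) (hY : MeasurableSet Y)
    (hf : IntegrableOn (fun x => exp (-f x)) X) (hg : IntegrableOn (fun z => exp (-g z)) Y)
    (hψ : IsQuadraticWell (affineRemainder ψ p y) A m) (hyY : y ∈ interior Y)
    (hpX : p ∈ interior X) (hgc : ContinuousAt g y) (ht : 0 < t) :
    0 < ∫ x in X, sinkhornOuter Y f g (t ^ 2) ψ y x :=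
  setIntegral_pos_of_forall_pos ⟨p, hpX⟩
    (fun x => mul_pos (div_pos (exp_pos _) (setIntegral_sinkhornInner_pos hY hg hyY hψ ht x))
      (exp_pos _))
    (integrableOn_sinkhornOuter hX hY hf hg hψ hyY hgc ht)

theorem tendsto_sinkhornStep_sub_div_sq (hX : MeasurableSet X) (hY : MeasurableSet Y)
    (hf : IntegrableOn (fun x => exp (-f x)) X) (hg : IntegrableOn (fun z => exp (-g z)) Y)
    (hψ : IsQuadraticWell (affineRemainder ψ p y) A m) (hyY : y ∈ interior Y)
    (hpX : p ∈ interior X) (hfc : ContinuousAt f p) (hgc : ContinuousAt g y) :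
    Tendsto (fun t : ℝ => (sinkhornStep X Y f g (t ^ 2) ψ y - ψ y) / t ^ 2) (𝓝[>] 0)
      (𝓝 (-f p + g y + log A.det)) := by
  have hY0 := localDensity_zero (g := g) (interior_subset hyY)
  have hlim := hψ.tendsto_integral_inv_rescaledLaplace_mul (integrable_localDensity hY hg)
    (continuousAt_localDensity_zero hyY hgc) (localDensity_nonneg Y g y)
    (hY0 ▸ exp_pos _) (integrable_localDensity hX hf) (continuousAt_localDensity_zero hpX hfc)
  have hdet : A.det ≠ 0 := det_ne_zero_of_quadratic_le hψ.pos hψ.quadratic_le_inner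
  rw [hY0, localDensity_zero (interior_subset hpX), exp_neg (g y), inv_inv] at hlim
  have hlog := hlim.log (by positivity)
  rw [log_mul (by positivity) (exp_pos _).ne', log_mul (by positivity) (exp_pos _).ne', log_abs,
    log_exp, log_exp] at hlog
  rw [show -f p + g y + log A.det = log A.det + g y + -f p by ring]
  refine hlog.congr' ?_
  filter_upwards [self_mem_nhdsWithin] with t ht
  exact (sinkhornStep_sub_div_sq hX hY ht p
    (setIntegral_sinkhornOuter_pos hX hY hf hg hψ hyY hpX hgc ht)).symm

end Sinkhorn

theorem tendsto_sqrt_nhdsGT_zero : Tendsto sqrt (𝓝[>] 0) (𝓝[>] 0) := by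
  refine tendsto_nhdsWithin_iff.2 ⟨?_, eventually_mem_nhdsWithin.mono fun _ => sqrt_pos.2⟩
  have hcont : ContinuousAt sqrt 0 := continuous_sqrt.continuousAt
  simpa only [ContinuousAt, sqrt_zero] using hcont.mono_left nhdsWithin_le_nhds

theorem IsUniformlyStronglyConvexC2.exists_isQuadraticWell {d : ℕ}
    {ψ : EuclideanSpace ℝ (Fin d) → ℝ} (hψ : IsUniformlyStronglyConvexC2 ψ)
    (y : EuclideanSpace ℝ (Fin d)) :
    ∃ m, IsQuadraticWell (affineRemainder ψ (gradient ψ y) y) (hessian ψ y) m := by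
  obtain ⟨m, hm, hle⟩ := hψ.exists_pos
  have hdiff : Differentiable ℝ ψ := hψ.contDiff.differentiable (by norm_num)
  have hgrad : ContDiff ℝ 1 (gradient ψ) :=
    (InnerProductSpace.toDual ℝ _).symm.contDiff.comp
      (hψ.contDiff.fderiv_right (m := 1) (by norm_num))
  have hhess (z : EuclideanSpace ℝ (Fin d)) : HasFDerivAt (gradient ψ) (hessian ψ z) z :=
    (hgrad.differentiable one_ne_zero z).hasFDerivAt
  exact ⟨m, {
    pos := hm
    measurable := by
      have hcont := hdiff.continuous
      unfold affineRemainder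
      fun_prop
    isSymmetric := isSymmetric_of_hasFDerivAt_gradient (Eventually.of_forall hdiff) (hhess y)
    quadratic_le := quadratic_le_taylor_gradient hdiff hhess hle y
    isLittleO := isLittleO_taylor_gradient (Eventually.of_forall hdiff) (hhess y) }⟩

theorem mainTheorem8_general {d : ℕ} {X Y : Set (EuclideanSpace ℝ (Fin d))}
    {f g : EuclideanSpace ℝ (Fin d) → ℝ} (hX : MeasurableSet X) (hY : MeasurableSet Y)
    (hf : IntegrableOn (fun x => exp (-f x)) X) (hg : IntegrableOn (fun z => exp (-g z)) Y)
    {ψ : EuclideanSpace ℝ (Fin d) → ℝ} {p y : EuclideanSpace ℝ (Fin d)}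
    {A : EuclideanSpace ℝ (Fin d) →L[ℝ] EuclideanSpace ℝ (Fin d)} {m : ℝ}
    (hψ : IsQuadraticWell (affineRemainder ψ p y) A m)
    (hyY : y ∈ interior Y) (hpX : p ∈ interior X)
    (hfc : ContinuousAt f p) (hgc : ContinuousAt g y) :
    (∀ ε : ℝ, 0 < ε →
      (∀ x, IntegrableOn (sinkhornInner g ε ψ x) Y volume ∧
        0 < ∫ y' in Y, sinkhornInner g ε ψ x y') ∧
      IntegrableOn (sinkhornOuter Y f g ε ψ y) X volume ∧
        0 < ∫ x in X, sinkhornOuter Y f g ε ψ y x) ∧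
    Tendsto (fun ε : ℝ => (sinkhornStep X Y f g ε ψ y - ψ y) / ε) (𝓝[>] 0)
      (𝓝 (-f p + g y + log A.det)) := by
  refine ⟨fun ε hε => ?_, ?_⟩
  · have ht := sqrt_pos.2 hε
    rw [← sq_sqrt hε.le]
    exact ⟨fun x => ⟨integrableOn_sinkhornInner hY hg hψ ht x,
        setIntegral_sinkhornInner_pos hY hg hyY hψ ht x⟩,
      integrableOn_sinkhornOuter hX hY hf hg hψ hyY hgc ht,
      setIntegral_sinkhornOuter_pos hX hY hf hg hψ hyY hpX hgc ht⟩
  · refine ((tendsto_sinkhornStep_sub_div_sq hX hY hf hg hψ hyY hpX hfc hgc).comp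
      tendsto_sqrt_nhdsGT_zero).congr' ?_
    filter_upwards [self_mem_nhdsWithin] with ε (hε : 0 < ε)
    simp only [Function.comp_apply, sq_sqrt hε.le]

theorem mainTheorem8 {d : ℕ} (X Y : Set (EuclideanSpace ℝ (Fin d)))
    (f g : EuclideanSpace ℝ (Fin d) → ℝ)
    (hf : IsProbDensityOn X f) (hg : IsProbDensityOn Y g)
    (ψ : EuclideanSpace ℝ (Fin d) → ℝ) (hψ : IsUniformlyStronglyConvexC2 ψ)
    (y : EuclideanSpace ℝ (Fin d))
    (hyY : y ∈ interior Y) (hyX : gradient ψ y ∈ interior X)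
    (hfc : ContinuousAt f (gradient ψ y)) (hgc : ContinuousAt g y) :
    (∀ ε : ℝ, 0 < ε →
      (∀ x, IntegrableOn (sinkhornInner g ε ψ x) Y volume ∧
        0 < ∫ y' in Y, sinkhornInner g ε ψ x y') ∧
      IntegrableOn (sinkhornOuter Y f g ε ψ y) X volume ∧
        0 < ∫ x in X, sinkhornOuter Y f g ε ψ y x) ∧
    Tendsto (fun ε : ℝ => (sinkhornStep X Y f g ε ψ y - ψ y) / ε) (𝓝[>] 0)
      (𝓝 (-f (gradient ψ y) + g y + log (hessian ψ y).det)) := by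
  obtain ⟨m, hwell⟩ := hψ.exists_isQuadraticWell y
  exact mainTheorem8_general hf.measurableSet hg.measurableSet hf.integrableOn hg.integrableOn
    hwell hyY hyX hfc hgc
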